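/- Partitions are identified with their diagrams. For partitions $\mu\subseteq\lambda$ and $\nu$, the Littlewood–Richardson coefficient $c(\lambda;\mu,\nu)$ is the number of semistandard tableaux of shape $\lambda/\mu$ and content $\nu$ whose reverse row word (rows read from right to left, top to bottom) is a lattice word, and the skew character is $[\lambda/\mu]=\sum_\nu c(\lambda;\mu,\nu)[\nu]$, where $[\nu]$ is the irreducible character of the symmetric group labelled by $\nu$. The components of $[\lambda/\mu]$ are the $[\nu]$ with $c(\lambda;\mu,\nu)\neq 0$, and its number of constituents is $\sum_\nu c(\lambda;\mu,\nu)$. Let $f^\nu$ be the number of standard Young tableaux of shape $\nu$, $f_n$ the number of standard Young tableaux with $n$ boxes (of any shape), $p_n$ the number of partitions of $n$, and $g_n$ the number of unordered pairs $\{\nu^1,\nu^2\}$ of partitions of $n$ with $|\nu^1\cap\nu^2|=n-1$. **Lemma.** Let $\lambda/\mu$ be a skew diagram with $|\lambda/\mu|=n$, and let $\lambda=(\lambda_1,\dots,\lambda_l)$ with $l$ nonzero parts. Then $[\lambda/\mu]$ contains at most - $g_n$ unordered pairs of components $\{[\nu^1],[\nu^2]\}$ such that $|\nu^1\cap\nu^2|=n-1$,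 - $p_n$ components, - $\min(f_n,\;p_nf^\mu,\;p_nf^{\bar\lambda})$ constituents, where $\bar\lambda=(\lambda_1-\lambda_l,\lambda_1-\lambda_{l-1},\dots,\lambda_1-\lambda_2,0)$ (and $\bar\lambda=\emptyset$ if $\lambda=\emptyset$). -/

import Mathlib

/-! Partitions are identified with their (left-justified) diagrams, Mathlib's `YoungDiagram`.
Boxes are pairs (row, column), and rows and columns are indexed from `0`: the part of `μ` that is
usually written with index `i + 1` is `μ.rowLen i`. -/

namespace SkewBounds

/-- The boxes of the skew diagram `lam/μ`. -/
def skewBoxes (lam μ : YoungDiagram) : Finset (ℕ × ℕ) :=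
  lam.cells \ μ.cells

/-- `T` is a semistandard tableau of shape `lam/μ`: a filling of the boxes by positive integers,
weakly increasing along the rows and strictly increasing down the columns. (The function `T` is `0`
outside the shape, so that different functions are different fillings.) -/
structure IsSemistandard (lam μ : YoungDiagram) (T : ℕ × ℕ → ℕ) : Prop where
  pos : ∀ c ∈ skewBoxes lam μ, 1 ≤ T c
  zero : ∀ c ∉ skewBoxes lam μ, T c = 0
  row_weak : ∀ i j₁ j₂ : ℕ, j₁ < j₂ → (i, j₁) ∈ skewBoxes lam μ → (i, j₂) ∈ skewBoxes lam μ →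
    T (i, j₁) ≤ T (i, j₂)
  col_strict : ∀ i₁ i₂ j : ℕ, i₁ < i₂ → (i₁, j) ∈ skewBoxes lam μ → (i₂, j) ∈ skewBoxes lam μ →
    T (i₁, j) < T (i₂, j)

/-- The filling `T` of `lam/μ` has content `ν`: the entry `i + 1` occurs `ν.rowLen i` times. -/
def HasContent (lam μ ν : YoungDiagram) (T : ℕ × ℕ → ℕ) : Prop :=
  ∀ i : ℕ, ((skewBoxes lam μ).filter (fun c => T c = i + 1)).card = ν.rowLen i

/-- The reverse row word: the entries are read from right to left in each row, the rows from top to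
bottom. Row `i` of `lam/μ` consists of the columns `j` with `μ.rowLen i ≤ j < lam.rowLen i`. -/
def reverseRowWord (lam μ : YoungDiagram) (T : ℕ × ℕ → ℕ) : List ℕ :=
  (List.range (lam.colLen 0)).flatMap fun i =>
    (List.range' (μ.rowLen i) (lam.rowLen i - μ.rowLen i)).reverse.map fun j => T (i, j)

/-- A lattice word: among the first `k` terms, each `i ≥ 1` occurs at least as often as `i + 1`. -/
def IsLatticeWord (w : List ℕ) : Prop :=
  ∀ i k : ℕ, 1 ≤ i → (w.take k).count (i + 1) ≤ (w.take k).count i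

/-- Littlewood-Richardson tableaux of shape `lam/μ` and content `ν`. -/
structure IsLRTableau (lam μ ν : YoungDiagram) (T : ℕ × ℕ → ℕ) : Prop where
  semistandard : IsSemistandard lam μ T
  content : HasContent lam μ ν T
  lattice : IsLatticeWord (reverseRowWord lam μ T)

/-- The Littlewood-Richardson coefficient `c(lam; μ, ν)`, for `μ ≤ lam`. -/
noncomputable def lrCoeff (lam μ ν : YoungDiagram) : ℕ :=
  Nat.card {T : ℕ × ℕ → ℕ // IsLRTableau lam μ ν T}

/-- `T` is a standard Young tableau of shape `μ`: a filling of the boxes by the numbers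
`1, …, |μ|`, each used once, increasing along rows and down columns (and `0` outside `μ`). -/
structure IsStandard (μ : YoungDiagram) (T : ℕ × ℕ → ℕ) : Prop where
  bij : Set.BijOn T (μ.cells : Set (ℕ × ℕ)) (Set.Icc 1 μ.card)
  zero : ∀ c ∉ μ.cells, T c = 0
  row_strict : ∀ i j₁ j₂ : ℕ, j₁ < j₂ → (i, j₁) ∈ μ → (i, j₂) ∈ μ → T (i, j₁) < T (i, j₂)
  col_strict : ∀ i₁ i₂ j : ℕ, i₁ < i₂ → (i₁, j) ∈ μ → (i₂, j) ∈ μ → T (i₁, j) < T (i₂, j)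

/-- `f^μ`: the number of standard Young tableaux of shape `μ`. -/
noncomputable def numSYT (μ : YoungDiagram) : ℕ :=
  Nat.card {T : ℕ × ℕ → ℕ // IsStandard μ T}

/-- `f_n`: the number of standard Young tableaux with `n` boxes, of any shape. -/
noncomputable def numSYTOfSize (n : ℕ) : ℕ :=
  Nat.card (Σ μ : {μ : YoungDiagram // μ.card = n}, {T : ℕ × ℕ → ℕ // IsStandard μ.1 T})

/-- `p_n`: the number of partitions of `n`. -/
def numPartitions (n : ℕ) : ℕ :=
  Fintype.card (Nat.Partition n)

theorem cells_subset_range (μ : YoungDiagram) :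
    μ.cells ⊆ Finset.range μ.card ×ˢ Finset.range μ.card := by
  rintro ⟨i, j⟩ h
  have hr : μ.rowLen i ≤ μ.card := by
    rw [YoungDiagram.rowLen_eq_card]; exact Finset.card_le_card (Finset.filter_subset _ _)
  have hc : μ.colLen j ≤ μ.card := by
    rw [YoungDiagram.colLen_eq_card]; exact Finset.card_le_card (Finset.filter_subset _ _)
  have h1 := YoungDiagram.mem_iff_lt_rowLen.1 ((YoungDiagram.mem_cells _).1 h)
  have h2 := YoungDiagram.mem_iff_lt_colLen.1 ((YoungDiagram.mem_cells _).1 h)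
  simp only [Finset.mem_product, Finset.mem_range]
  omega

theorem finite_card_eq (n : ℕ) : {ν : YoungDiagram | ν.card = n}.Finite := by
  refine Set.Finite.of_finite_image (f := YoungDiagram.cells) ?_ ?_
  · refine (Finset.finite_toSet (Finset.range n ×ˢ Finset.range n).powerset).subset ?_
    rintro _ ⟨ν, rfl, rfl⟩
    exact Finset.mem_coe.2 (Finset.mem_powerset.2 (cells_subset_range ν))
  · intro a _ b _ h
    exact YoungDiagram.ext h

/-- The partitions of `n`, as diagrams. -/
noncomputable def diagramsOfSize (n : ℕ) : Finset YoungDiagram :=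
  (finite_card_eq n).toFinset

theorem card_eq_sum_rowLen (ν : YoungDiagram) {N : ℕ} (hN : ν.colLen 0 ≤ N) :
    ν.card = ∑ i ∈ Finset.range N, ν.rowLen i := by
  have := Finset.card_eq_sum_card_fiberwise (f := Prod.fst) (s := ν.cells)
    (t := Finset.range N) (by
      rintro ⟨i, j⟩ h
      have h' : (i, 0) ∈ ν := ν.up_left_mem le_rfl (Nat.zero_le j) ((YoungDiagram.mem_cells _).1 h)
      have := YoungDiagram.mem_iff_lt_colLen.1 h'
      simp only [Finset.coe_range, Set.mem_Iio]
      omega)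
  rw [YoungDiagram.card, this]
  exact Finset.sum_congr rfl fun i _ => (YoungDiagram.rowLen_eq_card ν).symm

theorem IsLRTableau.card_eq {lam μ ν : YoungDiagram} {T : ℕ × ℕ → ℕ} (h : IsLRTableau lam μ ν T) :
    ν.card = (skewBoxes lam μ).card := by
  obtain ⟨N, hN⟩ : ∃ N, ∀ c ∈ skewBoxes lam μ, T c ≤ N :=
    ⟨(skewBoxes lam μ).sup T, fun c hc => Finset.le_sup hc⟩
  rw [card_eq_sum_rowLen ν (Nat.le_add_right _ N),
    Finset.card_eq_sum_card_fiberwise (f := fun c => T c - 1) (s := skewBoxes lam μ)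
      (t := Finset.range (ν.colLen 0 + N)) (by
        intro c hc
        have h1 := h.semistandard.pos c hc
        have h2 := hN c hc
        simp only [Finset.coe_range, Set.mem_Iio]
        omega)]
  refine Finset.sum_congr rfl fun i _ => ?_
  rw [← h.content i]
  congr 1
  refine Finset.filter_congr fun c hc => ?_
  have h1 := h.semistandard.pos c hc
  omega

/-- The skew character `[lam/μ] = ∑ ν, c(lam; μ, ν) [ν]`. The irreducible characters `[ν]` of the
symmetric group are a basis labelled by partitions, so a character is given by the multiplicity of
each `[ν]` in it. -/
noncomputable def skewCharacter (lam μ : YoungDiagram) : YoungDiagram →₀ ℕ :=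
  Finsupp.ofSupportFinite (lrCoeff lam μ) <|
    (finite_card_eq (skewBoxes lam μ).card).subset fun ν hν => by
      have hne : Nonempty {T : ℕ × ℕ → ℕ // IsLRTableau lam μ ν T} := by
        by_contra hemp
        rw [not_nonempty_iff] at hemp
        exact hν Nat.card_of_isEmpty
      obtain ⟨T, hT⟩ := hne
      exact hT.card_eq

/-- The labels `ν` of the components `[ν]` of a character, those with nonzero multiplicity. -/
def components (χ : YoungDiagram →₀ ℕ) : Finset YoungDiagram :=
  χ.support

/-- The number of constituents of a character: components counted with multiplicity. -/
def numConstituents (χ : YoungDiagram →₀ ℕ) : ℕ :=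
  χ.sum fun _ m => m

/-- The unordered pairs `{ν₁, ν₂}` of members of `S` with `|ν₁ ∩ ν₂| = n - 1`. -/
def oneBoxPairs (S : Finset YoungDiagram) (n : ℕ) : Finset (Sym2 YoungDiagram) :=
  S.sym2.filter fun s => s.inf.card + 1 = n

/-- `g_n`: the number of unordered pairs of partitions of `n` which differ by one box. -/
noncomputable def numOneBoxPairs (n : ℕ) : ℕ :=
  (oneBoxPairs (diagramsOfSize n) n).card

/-- For `lam = (lam₁, …, lam_l)` with `l` nonzero parts, the partition
`(lam₁ - lam_l, lam₁ - lam_{l-1}, …, lam₁ - lam₂, 0)`. -/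
def complement (lam : YoungDiagram) : YoungDiagram where
  cells := (Finset.range (lam.colLen 0) ×ˢ Finset.range (lam.rowLen 0)).filter
    fun c => c.2 < lam.rowLen 0 - lam.rowLen (lam.colLen 0 - 1 - c.1)
  isLowerSet := by
    rintro ⟨i, j⟩ ⟨i', j'⟩ ⟨hi, hj⟩ h
    simp only [Finset.coe_filter, Finset.mem_product, Finset.mem_range, Set.mem_ofPred_eq] at h ⊢
    simp only at hi hj
    have := lam.rowLen_anti (lam.colLen 0 - 1 - i) (lam.colLen 0 - 1 - i') (by omega)
    omega

end SkewBounds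

namespace SkewBounds

open Finset

/-! Every component has size `n`, which settles the pairs and the components. For constituents it
suffices to bound each `lrCoeff lam μ ν` by `numSYT α` for `α` equal to `ν`, `μ` and `complement
lam`; summing the first bound over `ν` gives `f_n`, and the other two are multiplied by `p_n`.

All three bounds come from the hive of an LR tableau: its value at `(i, k)`, `k ≤ i`, is the sum of
the first `i` values of `boundedLen` at level `k`. Its boundary carries the partial sums of `μ`, `ν`
and `lam`. The edges in the three directions are `boundedLen`, `topCount` and `diagonalStep`, and
the three kinds of rhombus inequality express column strictness, the lattice condition and
nonnegativity of `rowCount`. Slicing parallel to one side gives a Gelfand-Tsetlin pattern with top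
row `μ`, `ν` or, after subtraction from the first part of `lam`, `complement lam`. Each pattern
determines the tableau, and its row sums depend only on the boundary.

A pattern with top row `α` encodes a reverse semistandard filling of `α`, and its row sums fix the
content. A filling with known content is recovered from its standardization, so there are at most
`numSYT α` such patterns (`card_le_numSYT`). -/

theorem finite_isStandard (α : YoungDiagram) : Finite {T : ℕ × ℕ → ℕ // IsStandard α T} := by
  refine Finite.of_injective
    (fun (T : {T : ℕ × ℕ → ℕ // IsStandard α T}) (c : α.cells) =>
      (⟨T.1 c, Nat.lt_succ_of_le (T.2.bij.mapsTo c.2).2⟩ : Fin (α.card + 1))) ?_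
  intro T T' h
  refine Subtype.ext (funext fun c => ?_)
  by_cases hc : c ∈ α.cells
  · exact congrArg Fin.val (congrFun h ⟨c, hc⟩)
  · rw [T.2.zero c hc, T'.2.zero c hc]

/-! ### Standardization of reverse semistandard fillings -/

/-- A filling of `α` is reverse semistandard if it is weakly decreasing along the rows and strictly
decreasing down the columns. -/
structure IsReverseSemistandard (α : YoungDiagram) (e : ℕ × ℕ → ℕ) : Prop where
  row_weak : ∀ i j₁ j₂ : ℕ, j₁ < j₂ → (i, j₂) ∈ α → e (i, j₂) ≤ e (i, j₁)
  col_strict : ∀ i₁ i₂ j : ℕ, i₁ < i₂ → (i₂, j) ∈ α → e (i₂, j) < e (i₁, j)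

/-- The reading order of a reverse semistandard filling: larger entries first, equal entries from
left to right. -/
def Precedes (e : ℕ × ℕ → ℕ) (c' c : ℕ × ℕ) : Prop :=
  e c < e c' ∨ e c = e c' ∧ c'.2 ≤ c.2

open Classical in
/-- The standardization of a reverse semistandard filling: each box receives its position in the
reading order. -/
noncomputable def standardization (α : YoungDiagram) (e : ℕ × ℕ → ℕ) (c : ℕ × ℕ) : ℕ :=
  if c ∈ α then #{c' ∈ α.cells | Precedes e c' c} else 0

theorem Precedes.trans {e : ℕ × ℕ → ℕ} {a b c : ℕ × ℕ} (hab : Precedes e a b)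
    (hbc : Precedes e b c) : Precedes e a c := by
  unfold Precedes at *
  omega

theorem standardization_lt {α : YoungDiagram} {e : ℕ × ℕ → ℕ} {a b : ℕ × ℕ} (ha : a ∈ α)
    (hb : b ∈ α) (hab : Precedes e a b) (hba : ¬ Precedes e b a) :
    standardization α e a < standardization α e b := by
  classical
  rw [standardization, standardization, if_pos ha, if_pos hb]
  refine card_lt_card ((ssubset_iff_of_subset ?_).2 ⟨b, ?_, ?_⟩)
  · intro c hc
    rw [mem_filter] at hc ⊢
    exact ⟨hc.1, hc.2.trans hab⟩
  · exact mem_filter.2 ⟨(YoungDiagram.mem_cells _).2 hb, Or.inr ⟨rfl, le_rfl⟩⟩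
  · simp [hba]

theorem IsReverseSemistandard.isStandard_standardization {α : YoungDiagram} {e : ℕ × ℕ → ℕ}
    (he : IsReverseSemistandard α e) : IsStandard α (standardization α e) := by
  classical
  have hmaps : Set.MapsTo (standardization α e) (α.cells : Set (ℕ × ℕ)) (Finset.Icc 1 α.card) := by
    intro c hc
    have hc' : c ∈ α := (YoungDiagram.mem_cells _).1 hc
    rw [standardization, if_pos hc', coe_Icc]
    refine ⟨card_pos.2 ⟨c, mem_filter.2 ⟨hc, Or.inr ⟨rfl, le_rfl⟩⟩⟩, card_filter_le _ _⟩
  have htotal : ∀ a b, a ∈ α → b ∈ α → a ≠ b → ¬ Precedes e b a → Precedes e a b := by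
    rintro ⟨i, j⟩ ⟨i', j'⟩ ha hb hab h
    unfold Precedes at *
    dsimp only at *
    omega
  have hanti : ∀ a b, a ∈ α → b ∈ α → a ≠ b → Precedes e a b → ¬ Precedes e b a := by
    rintro ⟨i, j⟩ ⟨i', j'⟩ ha hb hab h h'
    unfold Precedes at h h'
    dsimp only at h h'
    -- Mutual precedence forces equal entries in one column, which column strictness excludes.
    obtain rfl : j = j' := by omega
    rcases lt_trichotomy i i' with hi | rfl | hi
    · have := he.col_strict _ _ _ hi hb; omega
    · exact hab rfl
    · have := he.col_strict _ _ _ hi ha; omega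
  have hinj : Set.InjOn (standardization α e) (α.cells : Set (ℕ × ℕ)) := by
    intro a ha b hb h
    by_contra hab
    have ha' : a ∈ α := (YoungDiagram.mem_cells _).1 ha
    have hb' : b ∈ α := (YoungDiagram.mem_cells _).1 hb
    by_cases hp : Precedes e a b
    · exact (standardization_lt ha' hb' hp (hanti a b ha' hb' hab hp)).ne h
    · have hq := htotal b a hb' ha' (Ne.symm hab) hp
      exact (standardization_lt hb' ha' hq hp).ne' h
  refine ⟨?_, ?_, ?_, ?_⟩
  · rw [← coe_Icc]
    refine ⟨hmaps, hinj, surjOn_of_injOn_of_card_le _ hmaps hinj ?_⟩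
    rw [Nat.card_Icc, Nat.add_sub_cancel]
  · intro c hc
    exact if_neg fun h => hc ((YoungDiagram.mem_cells _).2 h)
  · intro i j₁ j₂ hj h₁ h₂
    have := he.row_weak _ _ _ hj h₂
    refine standardization_lt h₁ h₂ ?_ ?_ <;> unfold Precedes <;> dsimp only <;> omega
  · intro i₁ i₂ j hi h₁ h₂
    have := he.col_strict _ _ _ hi h₂
    refine standardization_lt h₁ h₂ ?_ ?_ <;> unfold Precedes <;> dsimp only <;> omega

/-- The boxes with entry above `d` form an initial segment of the reading order. Hence
standardization and content together determine the filling. -/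
theorem lt_iff_standardization_le {α : YoungDiagram} (e : ℕ × ℕ → ℕ) {c : ℕ × ℕ} (hc : c ∈ α)
    (d : ℕ) : d < e c ↔ standardization α e c ≤ #{c' ∈ α.cells | d < e c'} := by
  classical
  rw [standardization, if_pos hc]
  constructor
  · intro h
    refine card_le_card (monotone_filter_right _ fun c' _ h' => ?_)
    unfold Precedes at h'
    omega
  · intro h
    by_contra hd
    refine absurd h (not_le.2 (card_lt_card ((ssubset_iff_of_subset ?_).2 ⟨c, ?_, ?_⟩)))
    · refine monotone_filter_right _ fun c' _ h' => ?_
      unfold Precedes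
      omega
    · exact mem_filter.2 ⟨(YoungDiagram.mem_cells _).2 hc, Or.inr ⟨rfl, le_rfl⟩⟩
    · simp [hd]

/-! ### Gelfand-Tsetlin patterns and their fillings -/

theorem card_eq_sum_card_rows {S : Finset (ℕ × ℕ)} {M : ℕ} {A : ℕ → Finset ℕ}
    (h : ∀ i j, (i, j) ∈ S ↔ i < M ∧ j ∈ A i) : #S = ∑ i ∈ range M, #(A i) := by
  rw [← card_sigma]
  refine card_nbij' (fun c => ⟨c.1, c.2⟩) (fun c => (c.1, c.2)) ?_ ?_ ?_ ?_
  · rintro ⟨i, j⟩ hc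
    simpa using (h i j).1 hc
  · rintro ⟨i, j⟩ hc
    exact (h i j).2 (by simpa using hc)
  · intro _ _; rfl
  · intro _ _; rfl

theorem rowLen_eq_zero {α : YoungDiagram} {i : ℕ} (hi : α.colLen 0 ≤ i) : α.rowLen i = 0 := by
  by_contra h
  have := YoungDiagram.mem_iff_lt_colLen.1
    (YoungDiagram.mem_iff_lt_rowLen.2 (Nat.pos_of_ne_zero h))
  omega

/-- `G` is a Gelfand-Tsetlin pattern with top row `α`; its row `d + 1` interlaces its row `d`. -/
structure IsGTPattern (α : YoungDiagram) (G : ℕ → ℕ → ℕ) : Prop where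
  top : ∀ i, G 0 i = α.rowLen i
  succ_le : ∀ d i, G (d + 1) i ≤ G d i
  le_succ : ∀ d i, G d (i + 1) ≤ G (d + 1) i
  bot : ∃ N, ∀ i, G N i = 0

namespace IsGTPattern

variable {α : YoungDiagram} {G : ℕ → ℕ → ℕ}

theorem antitone (h : IsGTPattern α G) (i : ℕ) : Antitone fun d => G d i :=
  antitone_nat_of_succ_le fun d => h.succ_le d i

theorem le_rowLen (h : IsGTPattern α G) (d i : ℕ) : G d i ≤ α.rowLen i :=
  h.top i ▸ h.antitone i (Nat.zero_le d)

theorem exists_filling (h : IsGTPattern α G) :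
    ∃ e : ℕ × ℕ → ℕ, ∀ c d, d < e c ↔ c.2 < G d c.1 := by
  classical
  obtain ⟨N, hN⟩ := h.bot
  have hex : ∀ c : ℕ × ℕ, ∃ d, G d c.1 ≤ c.2 := fun c => ⟨N, by simp [hN]⟩
  refine ⟨fun c => Nat.find (hex c), fun c d => ?_⟩
  rw [Nat.lt_find_iff]
  exact ⟨fun hd => not_le.1 (hd d le_rfl),
    fun hd m hm => not_le.2 (hd.trans_le (h.antitone c.1 hm))⟩

/-- The filling of `α` which corresponds to a Gelfand-Tsetlin pattern: the entry of a box is the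
number of rows of the pattern whose diagram contains the box. -/
noncomputable def filling (h : IsGTPattern α G) : ℕ × ℕ → ℕ :=
  h.exists_filling.choose

theorem lt_filling (h : IsGTPattern α G) (c : ℕ × ℕ) (d : ℕ) :
    d < h.filling c ↔ c.2 < G d c.1 :=
  h.exists_filling.choose_spec c d

theorem isReverseSemistandard (h : IsGTPattern α G) : IsReverseSemistandard α h.filling where
  row_weak i j₁ j₂ hj _ := by
    refine le_of_forall_lt fun d hd => ?_
    rw [h.lt_filling] at hd ⊢
    exact hj.trans hd
  col_strict i₁ i₂ j hi hc := by
    obtain ⟨i, rfl⟩ : ∃ i, i₂ = i + 1 := ⟨i₂ - 1, by omega⟩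
    have hanti : ∀ d, Antitone (G d) := fun d =>
      antitone_nat_of_succ_le fun k => (h.le_succ d k).trans (h.succ_le d k)
    rw [h.lt_filling]
    rcases Nat.eq_zero_or_pos (h.filling (i + 1, j)) with h0 | h0
    · rw [h0, h.top]
      exact (YoungDiagram.mem_iff_lt_rowLen.1 hc).trans_le (α.rowLen_anti _ _ hi.le)
    -- If the lower entry is `m + 1`, its box is still inside row `m` of the pattern; interlacing
    -- puts the box directly above row `i + 1` inside row `m + 1`.
    · obtain ⟨m, hm⟩ := Nat.exists_eq_succ_of_ne_zero h0.ne'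
      have hlt := (h.lt_filling (i + 1, j) m).1 (by omega)
      rw [hm]
      exact (hlt.trans_le (h.le_succ m i)).trans_le (hanti _ (by omega))

theorem card_filling (h : IsGTPattern α G) {M : ℕ} (hM : α.colLen 0 ≤ M) (d : ℕ) :
    #{c ∈ α.cells | d < h.filling c} = ∑ i ∈ range M, G d i := by
  rw [card_eq_sum_card_rows (M := M) (A := fun i => range (G d i))]
  · simp
  · intro i j
    have h1 := h.le_rowLen d i
    rw [mem_filter, h.lt_filling, mem_range, YoungDiagram.mem_cells,
      YoungDiagram.mem_iff_lt_rowLen]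
    have h2 := rowLen_eq_zero (α := α) (i := i)
    dsimp only
    omega

theorem eq_of_standardization_eq {G' : ℕ → ℕ → ℕ} (h : IsGTPattern α G) (h' : IsGTPattern α G')
    {M : ℕ} (hM : α.colLen 0 ≤ M) (hsum : ∀ d, ∑ i ∈ range M, G d i = ∑ i ∈ range M, G' d i)
    (hst : standardization α h.filling = standardization α h'.filling) : G = G' := by
  have key : ∀ d i j, j < G d i ↔ j < G' d i := by
    intro d i j
    by_cases hc : (i, j) ∈ α
    · rw [← h.lt_filling (i, j) d, ← h'.lt_filling (i, j) d, lt_iff_standardization_le _ hc,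
        lt_iff_standardization_le _ hc, hst, h.card_filling hM, h'.card_filling hM, hsum]
    · have := h.le_rowLen d i
      have := h'.le_rowLen d i
      rw [YoungDiagram.mem_iff_lt_rowLen] at hc
      omega
  exact funext fun d => funext fun i => eq_of_forall_lt_iff (key d i)

end IsGTPattern

/-- There are at most `f^α` Gelfand-Tsetlin patterns with top row `α` and prescribed row sums. -/
theorem card_le_numSYT {X : Type*} (α : YoungDiagram) (G : X → ℕ → ℕ → ℕ)
    (hG : ∀ x, IsGTPattern α (G x)) (hinj : Function.Injective G) {M : ℕ} (hM : α.colLen 0 ≤ M)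
    (hsum : ∀ x y d, ∑ i ∈ range M, G x d i = ∑ i ∈ range M, G y d i) :
    Nat.card X ≤ numSYT α := by
  have := finite_isStandard α
  refine Nat.card_le_card_of_injective
    (fun x => ⟨_, (hG x).isReverseSemistandard.isStandard_standardization⟩) fun x y hxy => ?_
  exact hinj ((hG x).eq_of_standardization_eq (hG y) hM (hsum x y) (congrArg Subtype.val hxy))

/-! ### Row statistics of a skew filling -/

/-- The number of entries `v` in row `i` of a filling of `lam/μ`. -/
def rowCount (lam μ : YoungDiagram) (T : ℕ × ℕ → ℕ) (i v : ℕ) : ℕ :=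
  #{j ∈ Ico (μ.rowLen i) (lam.rowLen i) | T (i, j) = v}

/-- The length of row `i` of the diagram formed by `μ` and the boxes with entries at most `k`. -/
def boundedLen (lam μ : YoungDiagram) (T : ℕ × ℕ → ℕ) (k i : ℕ) : ℕ :=
  μ.rowLen i + #{j ∈ Ico (μ.rowLen i) (lam.rowLen i) | T (i, j) ≤ k}

/-- The number of entries `j + 1` in the first `k` rows of a filling of `lam/μ`. -/
def topCount (lam μ : YoungDiagram) (T : ℕ × ℕ → ℕ) (k j : ℕ) : ℕ :=
  ∑ i ∈ range k, rowCount lam μ T i (j + 1)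

theorem mem_skewBoxes {lam μ : YoungDiagram} {i j : ℕ} :
    (i, j) ∈ skewBoxes lam μ ↔ j ∈ Ico (μ.rowLen i) (lam.rowLen i) := by
  rw [skewBoxes, mem_sdiff, YoungDiagram.mem_cells, YoungDiagram.mem_cells,
    YoungDiagram.mem_iff_lt_rowLen, YoungDiagram.mem_iff_lt_rowLen, Finset.mem_Ico]
  omega

theorem lt_colLen_of_mem_skewBoxes {lam μ : YoungDiagram} {i j : ℕ}
    (h : (i, j) ∈ skewBoxes lam μ) : i < lam.colLen 0 := by
  by_contra hi
  rw [mem_skewBoxes, Finset.mem_Ico, rowLen_eq_zero (not_lt.1 hi)] at h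
  omega

theorem rowLen_le_rowLen {lam μ : YoungDiagram} (hμ : μ ≤ lam) (i : ℕ) :
    μ.rowLen i ≤ lam.rowLen i := by
  by_contra h
  have := YoungDiagram.mem_iff_lt_rowLen.1
    (hμ (YoungDiagram.mem_iff_lt_rowLen.2 (not_le.1 h)))
  omega

section Filling

variable {lam μ ν : YoungDiagram} {T T' : ℕ × ℕ → ℕ}

theorem boundedLen_succ (k i : ℕ) :
    boundedLen lam μ T (k + 1) i = boundedLen lam μ T k i + rowCount lam μ T i (k + 1) := by
  rw [boundedLen, boundedLen, rowCount, add_assoc, ← card_union_of_disjoint, ← filter_or]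
  · congr 2
    exact filter_congr fun j _ => by omega
  · exact disjoint_filter.2 fun j _ h => by omega

theorem topCount_succ (k j : ℕ) :
    topCount lam μ T (k + 1) j = topCount lam μ T k j + rowCount lam μ T k (j + 1) :=
  sum_range_succ _ _

theorem topCount_zero (j : ℕ) : topCount lam μ T 0 j = 0 := rfl

theorem boundedLen_le_succ (k i : ℕ) : boundedLen lam μ T k i ≤ boundedLen lam μ T (k + 1) i :=
  boundedLen_succ (lam := lam) k i ▸ Nat.le_add_right _ _

theorem boundedLen_le (hμ : μ ≤ lam) (k i : ℕ) : boundedLen lam μ T k i ≤ lam.rowLen i := by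
  have h := card_filter_le (Ico (μ.rowLen i) (lam.rowLen i)) (fun j => T (i, j) ≤ k)
  have := rowLen_le_rowLen hμ i
  rw [Nat.card_Ico] at h
  rw [boundedLen]
  omega

theorem boundedLen_eq_zero (hμ : μ ≤ lam) {i : ℕ} (hi : lam.colLen 0 ≤ i) (k : ℕ) :
    boundedLen lam μ T k i = 0 :=
  Nat.le_zero.1 (rowLen_eq_zero hi ▸ boundedLen_le hμ k i)

theorem sum_rowCount (h : HasContent lam μ ν T) {K : ℕ} (hK : lam.colLen 0 ≤ K) (v : ℕ) :
    ∑ i ∈ range K, rowCount lam μ T i (v + 1) = ν.rowLen v := by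
  rw [← h v]
  refine (card_eq_sum_card_rows fun i j => ?_).symm
  rw [mem_filter, mem_filter, ← mem_skewBoxes]
  exact ⟨fun h => ⟨(lt_colLen_of_mem_skewBoxes h.1).trans_le hK, h⟩, fun h => h.2⟩

namespace IsSemistandard

theorem boundedLen_zero (h : IsSemistandard lam μ T) (i : ℕ) :
    boundedLen lam μ T 0 i = μ.rowLen i := by
  rw [boundedLen, Nat.add_eq_left, card_eq_zero, filter_eq_empty_iff]
  intro j hj
  have := h.pos _ (mem_skewBoxes.2 hj)
  omega

/-- Rows increase weakly, so the entries at most `k` fill an initial segment, which is determined by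
its cardinality. -/
theorem filter_le_eq_Ico (h : IsSemistandard lam μ T) (k i : ℕ) :
    {j ∈ Ico (μ.rowLen i) (lam.rowLen i) | T (i, j) ≤ k} =
      Ico (μ.rowLen i) (boundedLen lam μ T k i) := by
  set F := {j ∈ Ico (μ.rowLen i) (lam.rowLen i) | T (i, j) ≤ k} with hF
  have hcard : boundedLen lam μ T k i = μ.rowLen i + #F := rfl
  refine eq_of_subset_of_card_le ?_ (by rw [Nat.card_Ico, hcard, Nat.add_sub_cancel_left])
  intro j hj
  have hj' := mem_filter.1 hj
  have hsub : Ico (μ.rowLen i) (j + 1) ⊆ F := by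
    intro j' hj''
    have h1 := Finset.mem_Ico.1 hj'.1
    have h2 := Finset.mem_Ico.1 hj''
    have h3 : j' ∈ Ico (μ.rowLen i) (lam.rowLen i) := Finset.mem_Ico.2 (by omega)
    refine mem_filter.2 ⟨h3, ?_⟩
    rcases Nat.lt_or_ge j' j with hlt | hge
    · exact (h.row_weak i j' j hlt (mem_skewBoxes.2 h3) (mem_skewBoxes.2 hj'.1)).trans hj'.2
    · obtain rfl : j' = j := by omega
      exact hj'.2
  have hle := card_le_card hsub
  have h1 := Finset.mem_Ico.1 hj'.1
  rw [Nat.card_Ico] at hle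
  rw [Finset.mem_Ico, hcard]
  omega

theorem le_iff_lt_boundedLen (h : IsSemistandard lam μ T) {i j : ℕ}
    (hc : (i, j) ∈ skewBoxes lam μ) (k : ℕ) : T (i, j) ≤ k ↔ j < boundedLen lam μ T k i := by
  have hc' := mem_skewBoxes.1 hc
  have := Finset.ext_iff.1 (h.filter_le_eq_Ico k i) j
  rw [mem_filter, Finset.mem_Ico, Finset.mem_Ico] at this
  rw [Finset.mem_Ico] at hc'
  omega

theorem eq_of_boundedLen_eq (h : IsSemistandard lam μ T) (h' : IsSemistandard lam μ T')
    (hL : ∀ k i, boundedLen lam μ T k i = boundedLen lam μ T' k i) : T = T' := by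
  funext ⟨i, j⟩
  by_cases hc : (i, j) ∈ skewBoxes lam μ
  · refine eq_of_forall_ge_iff fun k => ?_
    rw [h.le_iff_lt_boundedLen hc, h'.le_iff_lt_boundedLen hc, hL]
  · rw [h.zero _ hc, h'.zero _ hc]

/-- This is column strictness: above an entry at most `k + 1` there is an entry at most `k` or a box
of `μ`. -/
theorem boundedLen_succ_le (h : IsSemistandard lam μ T) (hμ : μ ≤ lam) (k i : ℕ) :
    boundedLen lam μ T (k + 1) (i + 1) ≤ boundedLen lam μ T k i := by
  refine le_of_forall_lt fun j hj => ?_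
  have hlam := boundedLen_le (T := T) hμ (k + 1) (i + 1)
  have hanti := lam.rowLen_anti i (i + 1) (Nat.le_succ i)
  have hanti' := μ.rowLen_anti i (i + 1) (Nat.le_succ i)
  have hle : μ.rowLen i ≤ boundedLen lam μ T k i := Nat.le_add_right _ _
  by_cases hji : j < μ.rowLen i
  · omega
  · have hc : (i, j) ∈ skewBoxes lam μ := mem_skewBoxes.2 (Finset.mem_Ico.2 (by omega))
    have hc' : (i + 1, j) ∈ skewBoxes lam μ := mem_skewBoxes.2 (Finset.mem_Ico.2 (by omega))
    have h1 := (h.le_iff_lt_boundedLen hc' (k + 1)).2 hj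
    have h2 := h.col_strict i (i + 1) j (Nat.lt_succ_self i) hc hc'
    exact (h.le_iff_lt_boundedLen hc k).1 (by omega)

end IsSemistandard

/-! ### The lattice condition in terms of counts -/

/-- Row `i` of the reverse row word. -/
def reverseRow (lam μ : YoungDiagram) (T : ℕ × ℕ → ℕ) (i : ℕ) : List ℕ :=
  (List.range' (μ.rowLen i) (lam.rowLen i - μ.rowLen i)).reverse.map fun j => T (i, j)

theorem count_map_reverse_range' (f : ℕ → ℕ) (a b v : ℕ) :
    ((List.range' a (b - a)).reverse.map f).count v = #{j ∈ Ico a b | f j = v} := by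
  rw [List.map_reverse, List.count_reverse, List.count, List.countP_map,
    List.countP_eq_length_filter]
  change _ = Multiset.card (Multiset.filter _ (List.range' a (b - a) : Multiset ℕ))
  rw [Multiset.filter_coe, Multiset.coe_card]
  congr 1

theorem count_flatMap_reverseRow (k v : ℕ) :
    ((List.range k).flatMap (reverseRow lam μ T)).count (v + 1) = topCount lam μ T k v := by
  induction k with
  | zero => rfl
  | succ k ih =>
    rw [List.range_succ, List.flatMap_append, List.count_append, ih, topCount_succ,
      List.flatMap_singleton, reverseRow, count_map_reverse_range', rowCount]

theorem isPrefix_reverseRowWord {k : ℕ} (hk : k < lam.colLen 0) :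
    (List.range k).flatMap (reverseRow lam μ T) ++ reverseRow lam μ T k <+:
      reverseRowWord lam μ T := by
  obtain ⟨m, hm⟩ := Nat.exists_eq_add_of_le (Nat.succ_le_of_lt hk)
  refine ⟨((List.range m).map (k + 1 + ·)).flatMap (reverseRow lam μ T), ?_⟩
  change _ = (List.range (lam.colLen 0)).flatMap (reverseRow lam μ T)
  rw [hm, Nat.succ_eq_add_one, List.range_add (n := k + 1), List.range_succ (n := k),
    List.flatMap_append, List.flatMap_append, List.flatMap_singleton]

theorem IsLatticeWord.count_le_of_isPrefix {w u : List ℕ} (h : IsLatticeWord w) (hu : u <+: w)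
    {i : ℕ} (hi : 1 ≤ i) : u.count (i + 1) ≤ u.count i := by
  rw [List.prefix_iff_eq_take.1 hu]
  exact h i _ hi

namespace IsLRTableau

/-- The lattice condition is applied to the prefix that stops in row `k` just after the entries
above `j + 1`: it has seen every `j + 2` of that row but no `j + 1`. -/
theorem topCount_succ_le (h : IsLRTableau lam μ ν T) (hμ : μ ≤ lam) {k : ℕ}
    (hk : k < lam.colLen 0) (j : ℕ) :
    topCount lam μ T (k + 1) (j + 1) ≤ topCount lam μ T k j := by
  set b := boundedLen lam μ T (j + 1) k with hb
  have hb1 : μ.rowLen k ≤ b := Nat.le_add_right _ _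
  have hb2 : b ≤ lam.rowLen k := boundedLen_le hμ _ _
  have hsplit : reverseRow lam μ T k =
      (List.range' b (lam.rowLen k - b)).reverse.map (fun j => T (k, j)) ++
        (List.range' (μ.rowLen k) (b - μ.rowLen k)).reverse.map (fun j => T (k, j)) := by
    rw [← List.map_append, ← List.reverse_append, reverseRow]
    congr 2
    conv_rhs => rw [show b = μ.rowLen k + 1 * (b - μ.rowLen k) by omega]
    rw [show μ.rowLen k + 1 * (b - μ.rowLen k) - μ.rowLen k = b - μ.rowLen k by omega,
      List.range'_append]
    congr 1
    omega
  have hpre := (List.prefix_append _ _).trans (List.append_assoc _ _ _ ▸ hsplit ▸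
    isPrefix_reverseRowWord (μ := μ) (T := T) hk)
  have hle := h.lattice.count_le_of_isPrefix hpre (Nat.succ_pos j)
  rw [List.count_append, List.count_append, Nat.succ_eq_add_one, count_flatMap_reverseRow,
    count_flatMap_reverseRow, count_map_reverse_range', count_map_reverse_range'] at hle
  have hmem : ∀ j' ∈ Ico (μ.rowLen k) (lam.rowLen k), T (k, j') ≤ j + 1 ↔ j' < b :=
    fun j' hj' => h.semistandard.le_iff_lt_boundedLen (mem_skewBoxes.2 hj') (j + 1)
  have hzero : #{j' ∈ Ico b (lam.rowLen k) | T (k, j') = j + 1} = 0 := by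
    rw [card_eq_zero, filter_eq_empty_iff]
    intro j' hj' heq
    rw [Finset.mem_Ico] at hj'
    have := hmem j' (Finset.mem_Ico.2 (by omega))
    omega
  have hrow : rowCount lam μ T k (j + 1 + 1) =
      #{j' ∈ Ico b (lam.rowLen k) | T (k, j') = j + 1 + 1} := by
    rw [rowCount]
    congr 1
    ext j'
    rw [mem_filter, mem_filter]
    have := hmem j'
    rw [Finset.mem_Ico] at this ⊢
    rw [Finset.mem_Ico]
    omega
  rw [topCount_succ, hrow]
  omega

/-- Iterating the previous inequality up to the empty set of rows shows that entries in the first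
`k` rows are at most `k`. -/
theorem topCount_eq_zero (h : IsLRTableau lam μ ν T) (hμ : μ ≤ lam) {k j : ℕ}
    (hk : k ≤ lam.colLen 0) (hkj : k ≤ j) : topCount lam μ T k j = 0 := by
  induction k generalizing j with
  | zero => rfl
  | succ k ih =>
    obtain ⟨j, rfl⟩ : ∃ m, j = m + 1 := ⟨j - 1, by omega⟩
    exact Nat.le_zero.1 ((h.topCount_succ_le hμ (by omega) j).trans_eq (ih (by omega) (by omega)))

theorem boundedLen_eq_rowLen (h : IsLRTableau lam μ ν T) (hμ : μ ≤ lam) {k i : ℕ} (hi : i < k) :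
    boundedLen lam μ T k i = lam.rowLen i := by
  rcases Nat.lt_or_ge i (lam.colLen 0) with hl | hl
  · rw [boundedLen, filter_true_of_mem, Nat.card_Ico]
    · have := rowLen_le_rowLen hμ i
      omega
    · intro j hj
      by_contra hT
      have h0 := h.topCount_eq_zero hμ (k := i + 1) (j := T (i, j) - 1) (by omega) (by omega)
      rw [topCount_succ, show T (i, j) - 1 + 1 = T (i, j) by omega] at h0
      have : 0 < rowCount lam μ T i (T (i, j)) := card_pos.2 ⟨j, mem_filter.2 ⟨hj, rfl⟩⟩
      omega
  · rw [boundedLen_eq_zero hμ hl, rowLen_eq_zero hl]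

theorem sum_boundedLen (h : IsLRTableau lam μ ν T) {K : ℕ} (hK : lam.colLen 0 ≤ K) (k : ℕ) :
    ∑ i ∈ range K, boundedLen lam μ T k i =
      ∑ i ∈ range K, μ.rowLen i + ∑ v ∈ range k, ν.rowLen v := by
  induction k with
  | zero => simp [h.semistandard.boundedLen_zero]
  | succ k ih =>
    simp only [boundedLen_succ]
    rw [sum_add_distrib, ih, sum_rowCount h.content hK, sum_range_succ, add_assoc]

theorem topCount_colLen (h : IsLRTableau lam μ ν T) (j : ℕ) :
    topCount lam μ T (lam.colLen 0) j = ν.rowLen j :=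
  sum_rowCount h.content le_rfl j

end IsLRTableau

end Filling

/-! ### The bounds by `numSYT ν` and `numSYT μ` -/

theorem lrCoeff_le_numSYT_content {lam μ : YoungDiagram} (hμ : μ ≤ lam) (ν : YoungDiagram) :
    lrCoeff lam μ ν ≤ numSYT ν := by
  -- An actual tableau is needed below to see that `ν` has at most `l` rows.
  rcases isEmpty_or_nonempty {T : ℕ × ℕ → ℕ // IsLRTableau lam μ ν T} with hX | ⟨⟨T₀, h₀⟩⟩
  · rw [lrCoeff, Nat.card_of_isEmpty]
    exact Nat.zero_le _
  set l := lam.colLen 0 with hl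
  -- Row `d` of the pattern is the content of the first `l - d` rows; truncated subtraction makes it
  -- zero for `d ≥ l`.
  refine card_le_numSYT ν (M := l) (fun T d i => topCount lam μ T.1 (l - d) i) ?_ ?_ ?_ ?_
  · rintro ⟨T, h⟩
    refine ⟨fun i => ?_, fun d i => ?_, fun d i => ?_, l, fun i => ?_⟩
    · exact h.topCount_colLen i
    · exact sum_le_sum_of_subset (range_subset_range.2 (by omega))
    · dsimp only
      rcases Nat.lt_or_ge d l with hd | hd
      · obtain ⟨k, hk⟩ : ∃ k, l - d = k + 1 := ⟨l - d - 1, by omega⟩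
        rw [hk, show l - (d + 1) = k by omega]
        exact h.topCount_succ_le hμ (by omega) i
      · rw [show l - d = 0 by omega, topCount_zero]
        exact Nat.zero_le _
    · dsimp only
      rw [Nat.sub_self, topCount_zero]
  · rintro ⟨T, h⟩ ⟨T', h'⟩ hG
    refine Subtype.ext (h.semistandard.eq_of_boundedLen_eq h'.semistandard fun k i => ?_)
    have hB : ∀ m ≤ l, ∀ v, topCount lam μ T m v = topCount lam μ T' m v := by
      intro m hm v
      have := congrFun (congrFun hG (l - m)) v
      dsimp only at this
      rwa [Nat.sub_sub_self hm] at this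
    rcases Nat.lt_or_ge i l with hi | hi
    · induction k with
      | zero => rw [h.semistandard.boundedLen_zero, h'.semistandard.boundedLen_zero]
      | succ k ih =>
        have h1 := hB (i + 1) hi k
        have h2 := hB i hi.le k
        rw [topCount_succ, topCount_succ] at h1
        rw [boundedLen_succ, boundedLen_succ]
        dsimp only at ih ⊢
        omega
    · rw [boundedLen_eq_zero hμ hi, boundedLen_eq_zero hμ hi]
  · by_contra hM
    have h1 := h₀.topCount_colLen l
    rw [h₀.topCount_eq_zero hμ le_rfl le_rfl] at h1
    have := YoungDiagram.mem_iff_lt_rowLen.1 (YoungDiagram.mem_iff_lt_colLen.2 (not_le.1 hM))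
    omega
  -- Entries in the first `k ≤ l` rows are at most `l`, so the counts over `i < l` exhaust the boxes
  -- of these rows.
  · have key : ∀ (T : ℕ × ℕ → ℕ) (h : IsLRTableau lam μ ν T), ∀ k ≤ l,
        ∑ r ∈ range k, μ.rowLen r + ∑ i ∈ range l, topCount lam μ T k i =
          ∑ r ∈ range k, lam.rowLen r := by
      intro T h k hk
      have hrow : ∀ r m, boundedLen lam μ T m r =
          μ.rowLen r + ∑ v ∈ range m, rowCount lam μ T r (v + 1) := by
        intro r m
        induction m with
        | zero => simp [h.semistandard.boundedLen_zero]
        | succ m ih => rw [boundedLen_succ, ih, sum_range_succ, add_assoc]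
      simp only [topCount]
      rw [sum_comm, ← sum_add_distrib]
      refine sum_congr rfl fun r hr => ?_
      rw [← hrow, h.boundedLen_eq_rowLen hμ ((mem_range.1 hr).trans_le hk)]
    rintro ⟨T, h⟩ ⟨T', h'⟩ d
    have h1 := key T h (l - d) (Nat.sub_le _ _)
    have h2 := key T' h' (l - d) (Nat.sub_le _ _)
    dsimp only
    omega

theorem lrCoeff_le_numSYT_inner {lam μ : YoungDiagram} (hμ : μ ≤ lam) (ν : YoungDiagram) :
    lrCoeff lam μ ν ≤ numSYT μ := by
  set l := lam.colLen 0 with hl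
  -- The shift by `d` drops the rows above row `d`, which at level `d` have already reached their
  -- full length in `lam`.
  refine card_le_numSYT μ (M := l) (fun T d i => boundedLen lam μ T.1 d (d + i)) ?_ ?_ ?_ ?_
  · rintro ⟨T, h⟩
    refine ⟨fun i => ?_, fun d i => ?_, fun d i => ?_, l, fun i => ?_⟩
    · dsimp only
      rw [h.semistandard.boundedLen_zero, Nat.zero_add]
    · dsimp only
      rw [Nat.add_right_comm]
      exact h.semistandard.boundedLen_succ_le hμ d (d + i)
    · dsimp only
      rw [Nat.add_right_comm, ← add_assoc]
      exact boundedLen_le_succ d (d + i + 1)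
    · exact boundedLen_eq_zero hμ (Nat.le_add_right _ _) _
  · rintro ⟨T, h⟩ ⟨T', h'⟩ hG
    refine Subtype.ext (h.semistandard.eq_of_boundedLen_eq h'.semistandard fun k i => ?_)
    rcases Nat.lt_or_ge i k with hi | hi
    · rw [h.boundedLen_eq_rowLen hμ hi, h'.boundedLen_eq_rowLen hμ hi]
    · obtain ⟨m, rfl⟩ := Nat.exists_eq_add_of_le hi
      exact congrFun (congrFun hG k) m
  · by_contra hM
    have h1 := YoungDiagram.mem_iff_lt_rowLen.1 (YoungDiagram.mem_iff_lt_colLen.2 (not_le.1 hM))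
    have h2 := rowLen_le_rowLen hμ l
    rw [rowLen_eq_zero (α := lam) le_rfl] at h2
    omega
  · have key : ∀ (T : ℕ × ℕ → ℕ) (h : IsLRTableau lam μ ν T), ∀ d,
        ∑ i ∈ range d, lam.rowLen i + ∑ i ∈ range l, boundedLen lam μ T d (d + i) =
          ∑ i ∈ range (d + l), μ.rowLen i + ∑ v ∈ range d, ν.rowLen v := by
      intro T h d
      rw [← h.sum_boundedLen (Nat.le_add_left _ _), sum_range_add]
      congr 1
      exact sum_congr rfl fun i hi => (h.boundedLen_eq_rowLen hμ (mem_range.1 hi)).symm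
    rintro ⟨T, h⟩ ⟨T', h'⟩ d
    have h1 := key T h d
    have h2 := key T' h' d
    dsimp only
    omega

/-! ### Hive diagonals and the bound by `numSYT (complement lam)` -/

/-- The increment along a diagonal of the hive of an LR tableau, whose edge labels in the two other
directions are `boundedLen` and `topCount`. -/
def diagonalStep (lam μ : YoungDiagram) (T : ℕ × ℕ → ℕ) (d j : ℕ) : ℕ :=
  boundedLen lam μ T j (d + j) + topCount lam μ T (d + j + 1) j

section Diagonal

variable {lam μ ν : YoungDiagram} {T : ℕ × ℕ → ℕ}

theorem diagonalStep_eq (d j : ℕ) : diagonalStep lam μ T d j =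
    boundedLen lam μ T (j + 1) (d + j) + topCount lam μ T (d + j) j := by
  rw [diagonalStep, topCount_succ, boundedLen_succ]
  omega

theorem IsLRTableau.diagonalStep_zero (h : IsLRTableau lam μ ν T) (hμ : μ ≤ lam) {j : ℕ}
    (hj : j ≤ lam.colLen 0) : diagonalStep lam μ T 0 j = lam.rowLen j := by
  rw [diagonalStep_eq, Nat.zero_add, h.topCount_eq_zero hμ hj le_rfl,
    h.boundedLen_eq_rowLen hμ (Nat.lt_succ_self j), Nat.add_zero]

/-- With suitable decompositions of the two diagonal steps the `topCount` terms agree, leaving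
column strictness. -/
theorem IsLRTableau.diagonalStep_succ_le (h : IsLRTableau lam μ ν T) (hμ : μ ≤ lam) (d j : ℕ) :
    diagonalStep lam μ T (d + 1) j ≤ diagonalStep lam μ T d j := by
  rw [diagonalStep_eq, diagonalStep, Nat.add_right_comm]
  exact Nat.add_le_add_right (h.semistandard.boundedLen_succ_le hμ _ _) _

/-- Here the `boundedLen` terms agree, leaving the lattice condition. -/
theorem IsLRTableau.diagonalStep_le_succ (h : IsLRTableau lam μ ν T) (hμ : μ ≤ lam) {d j : ℕ}
    (hdj : d + j + 1 < lam.colLen 0) :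
    diagonalStep lam μ T d (j + 1) ≤ diagonalStep lam μ T (d + 1) j := by
  rw [diagonalStep_eq (d + 1), diagonalStep, Nat.add_right_comm d 1 j, ← add_assoc d j 1]
  exact Nat.add_le_add_left (h.topCount_succ_le hμ hdj j) _

theorem IsLRTableau.diagonalStep_le (h : IsLRTableau lam μ ν T) (hμ : μ ≤ lam) {d j : ℕ}
    (hj : j ≤ lam.colLen 0) : diagonalStep lam μ T d j ≤ lam.rowLen 0 := by
  have hanti : Antitone fun d => diagonalStep lam μ T d j :=
    antitone_nat_of_succ_le fun d => h.diagonalStep_succ_le hμ d j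
  refine (hanti (Nat.zero_le d)).trans ?_
  dsimp only
  rw [h.diagonalStep_zero hμ hj]
  exact lam.rowLen_anti 0 j (Nat.zero_le j)

/-- The sum telescopes: both sides are the hive value at `(d + m, m)`, reached from the `μ` side
along a diagonal. -/
theorem IsSemistandard.sum_diagonalStep (h : IsSemistandard lam μ T) (d m : ℕ) :
    ∑ i ∈ range d, μ.rowLen i + ∑ j ∈ range m, diagonalStep lam μ T d j =
      ∑ i ∈ range (d + m), boundedLen lam μ T m i := by
  induction m with
  | zero => simp [h.boundedLen_zero]
  | succ m ih =>
    rw [sum_range_succ, ← add_assoc, ih, ← add_assoc d m 1, sum_range_succ, diagonalStep_eq]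
    simp only [boundedLen_succ m, sum_add_distrib, topCount]
    omega

end Diagonal

theorem rowLen_complement (lam : YoungDiagram) (i : ℕ) : (complement lam).rowLen i =
    if i < lam.colLen 0 then lam.rowLen 0 - lam.rowLen (lam.colLen 0 - 1 - i) else 0 := by
  refine eq_of_forall_lt_iff fun j => ?_
  rw [← YoungDiagram.mem_iff_lt_rowLen, ← YoungDiagram.mem_cells, complement, mem_filter,
    mem_product, mem_range, mem_range]
  dsimp only
  split_ifs with h <;> omega

/-- The Gelfand-Tsetlin pattern with top row `complement lam` of an LR tableau. -/
def complementPattern (lam μ : YoungDiagram) (T : ℕ × ℕ → ℕ) (d i : ℕ) : ℕ :=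
  if d + i < lam.colLen 0 then
    lam.rowLen 0 - diagonalStep lam μ T d (lam.colLen 0 - 1 - (d + i)) else 0

theorem IsLRTableau.isGTPattern_complementPattern {lam μ ν : YoungDiagram} {T : ℕ × ℕ → ℕ}
    (h : IsLRTableau lam μ ν T) (hμ : μ ≤ lam) :
    IsGTPattern (complement lam) (complementPattern lam μ T) := by
  refine ⟨fun i => ?_, fun d i => ?_, fun d i => ?_, lam.colLen 0, fun i => ?_⟩
  · rw [complementPattern, rowLen_complement, Nat.zero_add, h.diagonalStep_zero hμ (by omega)]
  · rw [complementPattern, complementPattern]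
    by_cases hi : d + 1 + i < lam.colLen 0
    · obtain ⟨j, hj⟩ := Nat.exists_eq_add_of_lt hi
      rw [if_pos hi, if_pos (by omega),
        show lam.colLen 0 - 1 - (d + 1 + i) = j by omega,
        show lam.colLen 0 - 1 - (d + i) = j + 1 by omega]
      exact Nat.sub_le_sub_left (h.diagonalStep_le_succ hμ (by omega)) _
    · rw [if_neg hi]
      exact Nat.zero_le _
  · rw [complementPattern, complementPattern]
    by_cases hi : d + (i + 1) < lam.colLen 0
    · rw [if_pos hi, if_pos (by omega), show d + 1 + i = d + (i + 1) by omega]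
      exact Nat.sub_le_sub_left (h.diagonalStep_succ_le hμ _ _) _
    · rw [if_neg hi]
      exact Nat.zero_le _
  · exact if_neg (by omega)

theorem IsLRTableau.sum_complementPattern {lam μ ν : YoungDiagram} {T : ℕ × ℕ → ℕ}
    (h : IsLRTableau lam μ ν T) (hμ : μ ≤ lam) {d m : ℕ} (hdm : d + m = lam.colLen 0) :
    ∑ i ∈ range (lam.colLen 0), complementPattern lam μ T d i +
      ∑ j ∈ range m, diagonalStep lam μ T d j = m * lam.rowLen 0 := by
  have hsub : range m ⊆ range (lam.colLen 0) := range_subset_range.2 (by omega)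
  rw [← sum_subset hsub, ← sum_range_reflect (fun j => diagonalStep lam μ T d j),
    ← sum_add_distrib]
  · rw [← smul_eq_mul, ← card_range m, ← sum_const, card_range]
    refine sum_congr rfl fun i hi => ?_
    have hi := mem_range.1 hi
    rw [complementPattern, if_pos (by omega),
      show lam.colLen 0 - 1 - (d + i) = m - 1 - i by omega]
    exact Nat.sub_add_cancel (h.diagonalStep_le hμ (by omega))
  · intro i _ hi
    rw [mem_range] at hi
    exact if_neg (by omega)

theorem lrCoeff_le_numSYT_complement {lam μ : YoungDiagram} (hμ : μ ≤ lam) (ν : YoungDiagram) :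
    lrCoeff lam μ ν ≤ numSYT (complement lam) := by
  set l := lam.colLen 0 with hl
  refine card_le_numSYT (complement lam) (M := l) (fun T => complementPattern lam μ T.1)
    (fun T => T.2.isGTPattern_complementPattern hμ) ?_ ?_ ?_
  · rintro ⟨T, h⟩ ⟨T', h'⟩ hG
    have hdiag : ∀ d j, d + j < l → diagonalStep lam μ T d j = diagonalStep lam μ T' d j := by
      intro d j hdj
      have h1 := congrFun (congrFun hG d) (l - 1 - (d + j))
      dsimp only at h1
      rw [complementPattern, complementPattern, if_pos (by omega), if_pos (by omega),
        show lam.colLen 0 - 1 - (d + (l - 1 - (d + j))) = j by omega] at h1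
      have h2 := h.diagonalStep_le hμ (d := d) (j := j) (by omega)
      have h3 := h'.diagonalStep_le hμ (d := d) (j := j) (by omega)
      omega
    -- The diagonal steps recover all hive values from the `μ` side; their differences in `i` then
    -- give `boundedLen`.
    have hsum : ∀ k i, k ≤ i → i ≤ l →
        ∑ r ∈ range i, boundedLen lam μ T k r = ∑ r ∈ range i, boundedLen lam μ T' k r := by
      intro k i hki hil
      rw [← Nat.sub_add_cancel hki, ← h.semistandard.sum_diagonalStep,
        ← h'.semistandard.sum_diagonalStep]
      congr 1
      exact sum_congr rfl fun j hj => hdiag _ _ (by have := mem_range.1 hj; omega)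
    refine Subtype.ext (h.semistandard.eq_of_boundedLen_eq h'.semistandard fun k i => ?_)
    rcases Nat.lt_or_ge i k with hi | hi
    · rw [h.boundedLen_eq_rowLen hμ hi, h'.boundedLen_eq_rowLen hμ hi]
    rcases Nat.lt_or_ge i l with hil | hil
    · have h1 := hsum k (i + 1) (by omega) hil
      rw [sum_range_succ, sum_range_succ, hsum k i hi hil.le] at h1
      exact Nat.add_left_cancel h1
    · rw [boundedLen_eq_zero hμ hil, boundedLen_eq_zero hμ hil]
  · by_contra hM
    have h1 := YoungDiagram.mem_iff_lt_rowLen.1 (YoungDiagram.mem_iff_lt_colLen.2 (not_le.1 hM))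
    rw [rowLen_complement, if_neg (by omega)] at h1
    omega
  · rintro ⟨T, h⟩ ⟨T', h'⟩ d
    dsimp only
    rcases Nat.lt_or_ge l d with hd | hd
    · refine sum_congr rfl fun i _ => ?_
      rw [complementPattern, complementPattern, if_neg (by omega), if_neg (by omega)]
    -- The diagonal starting at `d` runs from the `μ` side to the `ν` side, so its total depends
    -- only on the boundary.
    · have hdm : d + (l - d) = l := by omega
      have h1 := h.sum_complementPattern hμ hdm
      have h2 := h'.sum_complementPattern hμ hdm
      have h3 := h.semistandard.sum_diagonalStep d (l - d)
      have h4 := h'.semistandard.sum_diagonalStep d (l - d)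
      rw [hdm, h.sum_boundedLen le_rfl] at h3
      rw [hdm, h'.sum_boundedLen le_rfl] at h4
      rw [← hl] at h1 h2
      omega

/-! ### Summation over the partitions of `n` -/

theorem mem_diagramsOfSize {n : ℕ} {ν : YoungDiagram} : ν ∈ diagramsOfSize n ↔ ν.card = n :=
  (finite_card_eq n).mem_toFinset

theorem card_diagramsOfSize_le (n : ℕ) : #(diagramsOfSize n) ≤ numPartitions n := by
  rw [numPartitions, ← Fintype.card_coe]
  have hsum : ∀ ν : YoungDiagram, ν.rowLens.sum = ν.card := fun ν => by
    rw [card_eq_sum_rowLen ν le_rfl, YoungDiagram.rowLens, sum_range]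
    rw [← List.sum_ofFn, List.ofFn_eq_map, ← List.map_coe_finRange_eq_range, List.map_map]
    rfl
  refine Fintype.card_le_of_injective
    (fun ν : diagramsOfSize n => (⟨ν.1.rowLens, fun hi => ν.1.pos_of_mem_rowLens _ hi,
      by rw [Multiset.sum_coe, hsum, mem_diagramsOfSize.1 ν.2]⟩ : Nat.Partition n)) ?_
  intro ν ν' h
  have hperm := Multiset.coe_eq_coe.1 (congrArg Nat.Partition.parts h)
  -- Both lists of row lengths are weakly decreasing, so equality as multisets is equality as lists.
  have heq := hperm.eq_of_sortedGE ν.1.rowLens_sorted ν'.1.rowLens_sorted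
  exact Subtype.ext (YoungDiagram.equivListRowLens.injective (Subtype.ext heq))

theorem numSYTOfSize_eq_sum (n : ℕ) : numSYTOfSize n = ∑ ν ∈ diagramsOfSize n, numSYT ν := by
  have : Finite {ν : YoungDiagram // ν.card = n} := finite_card_eq n
  have := fun ν => finite_isStandard ν
  have := Fintype.ofFinite {ν : YoungDiagram // ν.card = n}
  rw [numSYTOfSize, Nat.card_sigma]
  exact (sum_subtype _ (fun ν => mem_diagramsOfSize) numSYT).symm

theorem components_subset (lam μ : YoungDiagram) :
    components (skewCharacter lam μ) ⊆ diagramsOfSize #(skewBoxes lam μ) := by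
  intro ν hν
  have hne : lrCoeff lam μ ν ≠ 0 := Finsupp.mem_support_iff.1 hν
  obtain ⟨T, hT⟩ := (Nat.card_ne_zero.1 hne).1
  exact mem_diagramsOfSize.2 hT.card_eq

end SkewBounds

open SkewBounds in
theorem lemma3p12 (lam μ : YoungDiagram) (hμ : μ ≤ lam) (n : ℕ)
    (hn : (skewBoxes lam μ).card = n) :
    (oneBoxPairs (components (skewCharacter lam μ)) n).card ≤ numOneBoxPairs n ∧
    (components (skewCharacter lam μ)).card ≤ numPartitions n ∧
    numConstituents (skewCharacter lam μ) ≤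
      min (numSYTOfSize n)
        (min (numPartitions n * numSYT μ) (numPartitions n * numSYT (complement lam))) := by
  subst hn
  have hsub := components_subset lam μ
  have hcard := (Finset.card_le_card hsub).trans (card_diagramsOfSize_le _)
  have hbound : ∀ b, (∀ ν, lrCoeff lam μ ν ≤ b) →
      numConstituents (skewCharacter lam μ) ≤ numPartitions (skewBoxes lam μ).card * b :=
    fun b hb => (Finset.sum_le_card_nsmul _ _ b fun ν _ => hb ν).trans
      (Nat.mul_le_mul_right b hcard)
  refine ⟨Finset.card_le_card (Finset.filter_subset_filter _ (Finset.sym2_mono hsub)), hcard,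
    le_min ?_ (le_min (hbound _ (lrCoeff_le_numSYT_inner hμ))
      (hbound _ (lrCoeff_le_numSYT_complement hμ)))⟩
  rw [numSYTOfSize_eq_sum]
  exact (Finset.sum_le_sum fun ν _ => lrCoeff_le_numSYT_content hμ ν).trans
    (Finset.sum_le_sum_of_subset hsub)
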